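/- **Setting.** Let $S_\infty$ be the group of all permutations of $\omega$ with the topology of pointwise convergence and the metric $d(f,g)=2^{-\min\{k:\,f(k)\ne g(k)\}}$ ($f\neq g$), let $G$ be a closed subgroup of $S_\infty$, and let $(\mathbf X,\tau)$ be a compact Polish space, with a fixed compatible metric, on which $G$ acts continuously. Let $\mathcal N^G$ be the family of all sets $\{g\in G: g|_D=f|_D\}$ with $f\in G$ and $D\subset\omega$ finite, and $\mathcal V^G$ the family of all pointwise stabilizers in $G$ of finite sets $D\subset\omega$. For open $u\subseteq G$ and $B\subseteq \mathbf X$ let $B^{*u}$ (resp. $B^{\Delta u}$) be the set of all $x$ such that $\{g\in u: gx\in B\}$ is comeagre (resp. not meagre) in $u$. Let $\mathcal A$ be a countable basis of $\tau$, closed under $\cap$, each member of which is invariant under some $H\in\mathcal V^G$, and such that the clopen members of $\mathcal A$ generate $\tau$. Let $\mathcal B$ be a nice basis: a countable basis of a Polish topology $\mathbf t\supseteq\tau$ for which the action is still continuous, such that $\mathcal B$ is closed under $\cap$, under complements and under $B\mapsto B^{*u}$ for $u\in\mathcal N^G$, and each $B\in\mathcal B$ is invariant under some open subgroup of $G$.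 Assume that $\mathcal N^G$, $\mathcal A$ and $\mathcal B$ are 1-1-enumerated, each by (a decidable set of) natural numbers, so that $\mathcal B$ is computable. That is, the following are decidable in terms of the numbers: * in $\mathcal N^G$ and in $\mathcal A$: $\subseteq$, the graph of $\cap$, and the relation "$\mathrm{diam}(U)<2^{-i}$" for clopen $U$; the set of clopen members of $\mathcal A$; the set $\mathcal V^G$ as a subset of $\mathcal N^G$; * for $V\in\mathcal V^G$ and $U\in\mathcal A$: "$U$ is $V$-invariant"; * for all $m,n$: the relation "there is $g\in N$ with $V_{m+i}=gV_ig^{-1}$ for $1\le i\le m$ and $U_{n+j}=gU_j$ for $1\le j\le n$", where $N\in\mathcal N^G$, $V_1,\dots,V_{2m}\in\mathcal V^G$ and $U_1,\dots,U_{2n}\in\mathcal A$; * in $\mathcal B$: $\subseteq$, the graphs of complement and of $\cap$, "$B$ is $V$-invariant" ($V\in\mathcal V^G$), and the relations $B_1^{*u}=B_2$ and $B_1^{\Delta u}=B_2$ ($u\in\mathcal N^G$); and moreover $\mathcal A\subseteq\mathcal B$, and some computable function takes the number of each $A\in\mathcal A$ in $\mathcal A$ to its number in $\mathcal B$. A *$\tau$-canonical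 piece* is a non-empty set of the form $\bigcap_{A\in T}GA\cap\bigcap_{A\in\mathcal A\setminus T}(\mathbf X\setminus GA)$ with $T\subseteq\mathcal A$. A number $e$ *codes* a piece $Y$ if $\varphi_e$ is the (total) characteristic function of the set of numbers of those $A\in\mathcal A$ with $Y\subseteq GA$; $Y$ is *computable* if it has a code. For $e\in\omega$ and $B\in\mathcal B$ (given by its number), $\mathrm{Con}(e,B)$ holds if $e$ codes some $\tau$-canonical piece $Y$ with $B\cap Y\neq\emptyset$. **Proposition.** Under these assumptions there is a set $\mathcal O\subseteq\omega$ such that 1. every $e\in\mathcal O$ codes a computable $\tau$-canonical piece which is a $G$-orbit; 2. every code of a computable $\tau$-closed $\tau$-canonical piece which is a $G$-orbit belongs to $\mathcal O$; 3. $\mathcal O$ is $\Pi^0_3$ relative to $\mathrm{Con}$, i.e. there is a relation $R\subseteq\omega^4$, computable with oracle $\mathrm{Con}$, such that $e\in\mathcal O\iff\forall a\,\exists b\,\forall c\;R(e,a,b,c)$. -/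

import Mathlib

open scoped Pointwise

namespace PolishAction

/-! ### The group of permutations of the natural numbers and its closed subgroups -/

/-- The topology of pointwise convergence on the group of all permutations of `ℕ`
(`ℕ` is discrete). Closed subgroups carry the subspace topology. -/
instance permTopology : TopologicalSpace (Equiv.Perm ℕ) :=
  TopologicalSpace.induced (fun f : Equiv.Perm ℕ => (f : ℕ → ℕ)) inferInstance

open Classical in
/-- The usual left invariant metric: `d(f,g) = 2^(-min {k | f k ≠ g k})` for `f ≠ g`. -/
noncomputable def permDist (f g : Equiv.Perm ℕ) : ℝ :=
  if f = g then 0 else (1 / 2 : ℝ) ^ (sInf {k : ℕ | f k ≠ g k})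

/-- The family `𝒩^G` of all sets `{g ∈ G | g ⊇ σ}`, where `σ = f|_D` for some `f ∈ G` and
some finite `D ⊆ ℕ`. -/
def basicSets (G : Subgroup (Equiv.Perm ℕ)) : Set (Set G) :=
  {U | ∃ (f : G) (D : Finset ℕ),
    U = {g : G | ∀ k ∈ D, (g : Equiv.Perm ℕ) k = (f : Equiv.Perm ℕ) k}}

/-- The family `𝒱^G` of the basic subgroups: pointwise stabilizers in `G` of finite sets. -/
def basicSubgroups (G : Subgroup (Equiv.Perm ℕ)) : Set (Set G) :=
  {U | ∃ D : Finset ℕ, U = {g : G | ∀ k ∈ D, (g : Equiv.Perm ℕ) k = k}}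

/-- The diameter of `U` with respect to the distance `d` is less than `2^(-i)`. -/
def DiamLT {α : Type*} (d : α → α → ℝ) (U : Set α) (i : ℕ) : Prop :=
  ∃ r : ℝ, r < (1 / 2 : ℝ) ^ i ∧ ∀ x ∈ U, ∀ y ∈ U, d x y ≤ r

section Action

variable {G : Subgroup (Equiv.Perm ℕ)} {X : Type*} [MulAction G X]

/-! ### Saturations, Vaught transforms, invariance, canonical pieces -/

/-- `GA`, the union of all translates of `A`. -/
def saturation (G : Subgroup (Equiv.Perm ℕ)) {X : Type*} [MulAction G X] (A : Set X) : Set X :=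
  ⋃ g : G, g • A

/-- The Vaught transform `B^{*H}`: all `x` such that `{g ∈ H | gx ∈ B}` is comeagre in `H`. -/
def vaughtStar (B : Set X) (H : Set G) : Set X :=
  {x | {h : H | (h : G) • x ∈ B} ∈ residual H}

/-- The Vaught transform `B^{ΔH}`: all `x` such that `{g ∈ H | gx ∈ B}` is not meagre in `H`. -/
def vaughtDelta (B : Set X) (H : Set G) : Set X :=
  {x | ¬ IsMeagre {h : H | (h : G) • x ∈ B}}

/-- `B` is invariant under the elements of `H` (which is always a subgroup below). -/
def InvariantUnder (H : Set G) (B : Set X) : Prop :=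
  ∀ g ∈ H, ∀ x ∈ B, g • x ∈ B

/-- `Y` is a piece of the canonical partition of the `G`-space with basis `𝒜`: a nonempty set
of the form `⋂ {GA | A ∈ T} ∩ ⋂ {X \ GA | A ∈ 𝒜 \ T}` for some `T ⊆ 𝒜`. -/
def IsCanonicalPiece (G : Subgroup (Equiv.Perm ℕ)) {X : Type*} [MulAction G X]
    (𝒜 : Set (Set X)) (Y : Set X) : Prop :=
  Y.Nonempty ∧ ∃ T ⊆ 𝒜,
    Y = (⋂ A ∈ T, saturation G A) ∩ (⋂ A ∈ 𝒜 \ T, (saturation G A)ᶜ)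

/-! ### Bases of the space -/

/-- The requirements on the basis `𝒜` of the given topology of `X`. -/
structure IsAdmissibleBasis (G : Subgroup (Equiv.Perm ℕ)) {X : Type*} [MulAction G X]
    [TopologicalSpace X] (𝒜 : Set (Set X)) : Prop where
  countable : 𝒜.Countable
  basis : TopologicalSpace.IsTopologicalBasis 𝒜
  inter_mem : ∀ A₁ ∈ 𝒜, ∀ A₂ ∈ 𝒜, A₁ ∩ A₂ ∈ 𝒜
  invariant : ∀ A ∈ 𝒜, ∃ H ∈ basicSubgroups G, InvariantUnder H A
  clopen_generate : TopologicalSpace.generateFrom {A ∈ 𝒜 | IsClopen A} =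
    (inferInstance : TopologicalSpace X)

/-- `t` is a nice topology for the `G`-space `X` (with its given topology `τ`), and `ℬ` is a
nice basis of `t`. In Mathlib `t ≤ τ` means that `t` is finer than `τ`. -/
structure IsNiceBasisOf (G : Subgroup (Equiv.Perm ℕ)) {X : Type*} [MulAction G X]
    [τ : TopologicalSpace X] (t : TopologicalSpace X) (ℬ : Set (Set X)) : Prop where
  polish : @PolishSpace X t
  finer : t ≤ τ
  continuous_smul : @ContinuousSMul G X _ _ t
  basis : @TopologicalSpace.IsTopologicalBasis X t ℬ
  countable : ℬ.Countable
  inter_mem : ∀ B₁ ∈ ℬ, ∀ B₂ ∈ ℬ, B₁ ∩ B₂ ∈ ℬ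
  compl_mem : ∀ B ∈ ℬ, Bᶜ ∈ ℬ
  vaughtStar_mem : ∀ B ∈ ℬ, ∀ u ∈ basicSets G, vaughtStar B u ∈ ℬ
  invariant : ∀ B ∈ ℬ, ∃ H : Subgroup G, IsOpen (H : Set G) ∧ InvariantUnder (H : Set G) B

/-- `ℬ` is a nice basis, that is a nice basis of some nice topology for the `G`-space `X`
(which is determined by `ℬ`). -/
def IsNiceBasis (G : Subgroup (Equiv.Perm ℕ)) {X : Type*} [MulAction G X]
    [TopologicalSpace X] (ℬ : Set (Set X)) : Prop :=
  ∃ t, IsNiceBasisOf G t ℬ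

/-! ### Computable presentations -/

/-- A 1-1-enumeration of the family `𝒞` by the elements of a decidable set of natural numbers
(which may be finite, since `𝒞` may be finite). Outside `dom` the values are irrelevant. -/
structure FamilyNumbering {α : Type*} (𝒞 : Set α) where
  dom : Set ℕ
  val : ℕ → α
  bijOn : Set.BijOn val dom 𝒞
  dom_computable : ComputablePred (fun n : ℕ => n ∈ dom)

/-- The bases `𝒩^G` and `𝒜` are computably 1-1-enumerated, so that all the relations below
are decidable. -/
structure IsComputablePresentation {X : Type*} [MetricSpace X]
    {G : Subgroup (Equiv.Perm ℕ)} [MulAction G X] {𝒜 : Set (Set X)}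
    (νN : FamilyNumbering (basicSets G)) (νA : FamilyNumbering 𝒜) : Prop where
  /-- inclusion and intersection in `𝒩^G` -/
  subset_N : ComputablePred fun p : ℕ × ℕ =>
    p.1 ∈ νN.dom ∧ p.2 ∈ νN.dom ∧ νN.val p.1 ⊆ νN.val p.2
  inter_N : ComputablePred fun p : ℕ × ℕ × ℕ =>
    p.1 ∈ νN.dom ∧ p.2.1 ∈ νN.dom ∧ p.2.2 ∈ νN.dom ∧
      νN.val p.1 ∩ νN.val p.2.1 = νN.val p.2.2
  /-- inclusion and intersection in `𝒜` -/
  subset_A : ComputablePred fun p : ℕ × ℕ =>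
    p.1 ∈ νA.dom ∧ p.2 ∈ νA.dom ∧ νA.val p.1 ⊆ νA.val p.2
  inter_A : ComputablePred fun p : ℕ × ℕ × ℕ =>
    p.1 ∈ νA.dom ∧ p.2.1 ∈ νA.dom ∧ p.2.2 ∈ νA.dom ∧
      νA.val p.1 ∩ νA.val p.2.1 = νA.val p.2.2
  /-- the predicates `Clopen` on `𝒜` and `𝒱^G` on `𝒩^G` -/
  clopen_A : ComputablePred fun n : ℕ => n ∈ νA.dom ∧ IsClopen (νA.val n)
  basicSubgroup_N : ComputablePred fun n : ℕ =>
    n ∈ νN.dom ∧ νN.val n ∈ basicSubgroups G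
  /-- the diameter of a basic clopen set is less than `2^(-i)` (all members of `𝒩^G` are
  clopen) -/
  diam_N : ComputablePred fun p : ℕ × ℕ =>
    p.1 ∈ νN.dom ∧
      DiamLT (fun f g : G => permDist (f : Equiv.Perm ℕ) (g : Equiv.Perm ℕ)) (νN.val p.1) p.2
  diam_A : ComputablePred fun p : ℕ × ℕ =>
    p.1 ∈ νA.dom ∧ IsClopen (νA.val p.1) ∧
      DiamLT (fun x y : X => dist x y) (νA.val p.1) p.2
  /-- `Inv(V, U)` -/
  inv_A : ComputablePred fun p : ℕ × ℕ =>
    (p.1 ∈ νN.dom ∧ νN.val p.1 ∈ basicSubgroups G) ∧ p.2 ∈ νA.dom ∧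
      InvariantUnder (νN.val p.1) (νA.val p.2)
  /-- `Orb_{m,n}(N, V, V', U, U')`: some `g ∈ N` satisfies `V'ᵢ = g Vᵢ g⁻¹` and `U'ⱼ = g Uⱼ`
  for all `i < m` and `j < n` -/
  orb : ∀ m n : ℕ, ComputablePred
    fun p : ℕ × (Fin m → ℕ) × (Fin m → ℕ) × (Fin n → ℕ) × (Fin n → ℕ) =>
      p.1 ∈ νN.dom ∧
      (∀ i, p.2.1 i ∈ νN.dom ∧ νN.val (p.2.1 i) ∈ basicSubgroups G) ∧
      (∀ i, p.2.2.1 i ∈ νN.dom ∧ νN.val (p.2.2.1 i) ∈ basicSubgroups G) ∧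
      (∀ j, p.2.2.2.1 j ∈ νA.dom) ∧
      (∀ j, p.2.2.2.2 j ∈ νA.dom) ∧
      ∃ g ∈ νN.val p.1,
        (∀ i, νN.val (p.2.2.1 i) = (fun v => g * v * g⁻¹) '' νN.val (p.2.1 i)) ∧
        (∀ j, νA.val (p.2.2.2.2 j) = g • νA.val (p.2.2.2.1 j))

/-- The basis `ℬ`, enumerated by `νB`, is computable (over the enumerations of `𝒩^G` and `𝒜`). -/
structure IsComputableBasis {X : Type*} [MetricSpace X]
    {G : Subgroup (Equiv.Perm ℕ)} [MulAction G X] {𝒜 ℬ : Set (Set X)}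
    (νN : FamilyNumbering (basicSets G)) (νA : FamilyNumbering 𝒜) (νB : FamilyNumbering ℬ) : Prop where
  presentation : IsComputablePresentation νN νA
  /-- a computable function finding the `ℬ`-numbers of the elements of `𝒜` -/
  translation : ∃ f : ℕ → ℕ, Computable f ∧
    ∀ n ∈ νA.dom, f n ∈ νB.dom ∧ νB.val (f n) = νA.val n
  subset_B : ComputablePred fun p : ℕ × ℕ =>
    p.1 ∈ νB.dom ∧ p.2 ∈ νB.dom ∧ νB.val p.1 ⊆ νB.val p.2
  compl_B : ComputablePred fun p : ℕ × ℕ =>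
    p.1 ∈ νB.dom ∧ p.2 ∈ νB.dom ∧ νB.val p.2 = (νB.val p.1)ᶜ
  inv_B : ComputablePred fun p : ℕ × ℕ =>
    (p.1 ∈ νN.dom ∧ νN.val p.1 ∈ basicSubgroups G) ∧ p.2 ∈ νB.dom ∧
      InvariantUnder (νN.val p.1) (νB.val p.2)
  inter_B : ComputablePred fun p : ℕ × ℕ × ℕ =>
    p.1 ∈ νB.dom ∧ p.2.1 ∈ νB.dom ∧ p.2.2 ∈ νB.dom ∧
      νB.val p.1 ∩ νB.val p.2.1 = νB.val p.2.2
  vaughtStar_B : ComputablePred fun p : ℕ × ℕ × ℕ =>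
    p.1 ∈ νB.dom ∧ p.2.1 ∈ νN.dom ∧ p.2.2 ∈ νB.dom ∧
      vaughtStar (νB.val p.1) (νN.val p.2.1) = νB.val p.2.2
  vaughtDelta_B : ComputablePred fun p : ℕ × ℕ × ℕ =>
    p.1 ∈ νB.dom ∧ p.2.1 ∈ νN.dom ∧ p.2.2 ∈ νB.dom ∧
      vaughtDelta (νB.val p.1) (νN.val p.2.1) = νB.val p.2.2

/-! ### Codes of pieces, and the relation `Con` -/

/-- `φ_e`, the partial computable function with index `e`. -/
def phi (e : ℕ) : ℕ →. ℕ := (Denumerable.ofNat Nat.Partrec.Code e).eval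

open Classical in
/-- `e` codes `Y`: `φ_e` is (total and is) the characteristic function of the set of all
numbers of those `A ∈ 𝒜` with `Y ⊆ GA`. In particular the piece `Y` is then computable
(decidable). -/
def Codes {𝒜 : Set (Set X)} (νA : FamilyNumbering 𝒜) (e : ℕ) (Y : Set X) : Prop :=
  ∀ n : ℕ, phi e n =
    Part.some (if n ∈ νA.dom ∧ Y ⊆ saturation G (νA.val n) then 1 else 0)

/-- `Con(e, B)`, where `B` is given by its number `b`. -/
def ConRel (G : Subgroup (Equiv.Perm ℕ)) {X : Type*} [MulAction G X] {𝒜 ℬ : Set (Set X)}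
    (νA : FamilyNumbering 𝒜) (νB : FamilyNumbering ℬ) (e b : ℕ) : Prop :=
  b ∈ νB.dom ∧ ∃ Y : Set X, IsCanonicalPiece G 𝒜 Y ∧ (νB.val b ∩ Y).Nonempty ∧
    Codes (G := G) νA e Y

end Action

/-! ### The relativized arithmetical class `Π⁰₃` -/

open Classical in
/-- The characteristic function of a binary relation, as an oracle. -/
noncomputable def relOracle (R : ℕ → ℕ → Prop) : ℕ →. ℕ :=
  fun n => Part.some (if R n.unpair.1 n.unpair.2 then 1 else 0)

/-- `S` is `Π⁰₃` relative to the binary relation `R`. -/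
def IsPiThreeIn (R : ℕ → ℕ → Prop) (S : Set ℕ) : Prop :=
  ∃ f : ℕ × ℕ × ℕ × ℕ → Bool, ComputableIn {relOracle R} f ∧
    ∀ e, e ∈ S ↔ ∀ a, ∃ b, ∀ c, f (e, a, b, c) = true

end PolishAction

open PolishAction

/-!
A canonical piece `Y` is a minimal `G`-space: the orbits of any two of its points meet the
same members of `𝒜`. Call the action on `Y` weakly microtransitive if `Vz` is dense near `z` for
every neighbourhood `V` of `1` and every `z ∈ Y`. By Baire category this holds when `Y` is a Polish
orbit (Effros), and conversely a minimal weakly microtransitive action of a Polish group is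
transitive: a back-and-forth construction moves two points `x`, `y` by Cauchy sequences `g n`,
`k n` in `G` so that the distance of `k n • y` and `g n • x` tends to `0`.

If `Y` is compact, then by a Lebesgue number argument the size of the neighbourhood of `z` can be
chosen for all `z ∈ Y` at once, depending on `V` only. So `𝒪` consists of the codes of the pieces
with this uniform property, which has the form `∀ V ∃ i ∀ A, A'`: for `A` clopen with
`diam A < 2^(-i)`, either `A ∩ A'` or `{w ∈ A | V w ∩ A' = ∅}` is disjoint from `Y`. The second set
is `A ∩ (A'ᶜ)^{*V}` as `A'` is open, so both sets belong to `ℬ`, and `Con` decides whether they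
meet `Y`.
-/

namespace PolishAction

open Filter Topology MulAction

section OracleComputability

variable {α β γ : Type*} [Primcodable α] [Primcodable β] [Primcodable γ] {O : Set (ℕ →. ℕ)}

theorem computableIn_comp {f : β → γ} {g : α → β} (hf : ComputableIn O f)
    (hg : ComputableIn O g) : ComputableIn O fun a => f (g a) := by
  refine (Nat.RecursiveIn.comp hf hg).of_eq fun n => ?_
  cases h : Encodable.decode (α := α) n <;> simp

theorem computableIn_pair {f : α → β} {g : α → γ} (hf : ComputableIn O f)
    (hg : ComputableIn O g) : ComputableIn O fun a => (f a, g a) := by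
  refine (Nat.RecursiveIn.pair hf hg).of_eq fun n => ?_
  cases h : Encodable.decode (α := α) n <;> simp [Seq.seq]

/-- Decidability relative to the oracles `O`; the relativization of `ComputablePred`. -/
def ComputablePredIn (O : Set (ℕ →. ℕ)) (p : α → Prop) : Prop :=
  ∃ _ : DecidablePred p, ComputableIn O fun a => decide (p a)

theorem computablePredIn_of_computablePred {p : α → Prop} (hp : ComputablePred p) :
    ComputablePredIn O p := by
  classical exact ⟨inferInstance, hp.decide.computableIn⟩

namespace ComputablePredIn

theorem comp {p : β → Prop} {g : α → β} (hp : ComputablePredIn O p) (hg : Computable g) :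
    ComputablePredIn O fun a => p (g a) := by
  obtain ⟨_, hp⟩ := hp
  exact ⟨inferInstance, computableIn_comp hp hg.computableIn⟩

theorem not {p : α → Prop} (hp : ComputablePredIn O p) : ComputablePredIn O fun a => ¬ p a := by
  obtain ⟨_, hp⟩ := hp
  refine ⟨inferInstance, ?_⟩
  simpa only [decide_not] using computableIn_comp Primrec.not.computableIn hp

theorem and {p q : α → Prop} (hp : ComputablePredIn O p) (hq : ComputablePredIn O q) :
    ComputablePredIn O fun a => p a ∧ q a := by
  obtain ⟨_, hp⟩ := hp
  obtain ⟨_, hq⟩ := hq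
  refine ⟨inferInstance, ?_⟩
  simpa only [Bool.decide_and] using
    computableIn_comp Primrec.and.computableIn₂ (computableIn_pair hp hq)

theorem imp {p q : α → Prop} (hp : ComputablePredIn O p) (hq : ComputablePredIn O q) :
    ComputablePredIn O fun a => p a → q a := by
  simpa only [not_and, not_not] using (hp.and hq.not).not

end ComputablePredIn

theorem computablePredIn_relOracle (R : ℕ → ℕ → Prop) :
    ComputablePredIn {relOracle R} fun p : ℕ × ℕ => R p.1 p.2 := by
  classical
  have hR : ComputableIn {relOracle R} fun n : ℕ => if R n.unpair.1 n.unpair.2 then 1 else 0 :=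
    RecursiveIn.oracle _ (Set.mem_singleton _)
  have hone : ComputablePred fun n : ℕ => n = 1 := (Primrec.eq.comp .id (.const 1)).computablePred
  have hpair : Computable fun p : ℕ × ℕ => Nat.pair p.1 p.2 := Primrec₂.natPair.to_comp
  refine ⟨inferInstance, ?_⟩
  convert computableIn_comp hone.decide.computableIn
    (computableIn_comp hR hpair.computableIn) using 2 with p
  simp

theorem exists_computable_surjective (α : Type*) [Primcodable α] [Nonempty α] :
    ∃ s : ℕ → α, Computable s ∧ s.Surjective := by
  inhabit α
  refine ⟨fun n => (Encodable.decode n).getD default,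
    Computable.option_getD Computable.decode (.const default), fun a => ⟨Encodable.encode a, ?_⟩⟩
  simp

theorem isPiThreeIn_setOf [Nonempty α] [Nonempty β] [Nonempty γ] {R : ℕ → ℕ → Prop}
    {P : ℕ × α × β × γ → Prop} (hP : ComputablePredIn {relOracle R} P) :
    IsPiThreeIn R {e | ∀ a, ∃ b, ∀ c, P (e, a, b, c)} := by
  obtain ⟨s, hs, hs_surj⟩ := exists_computable_surjective α
  obtain ⟨t, ht, ht_surj⟩ := exists_computable_surjective β
  obtain ⟨u, hu, hu_surj⟩ := exists_computable_surjective γ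
  have hstu : Computable fun p : ℕ × ℕ × ℕ × ℕ => (p.1, s p.2.1, t p.2.2.1, u p.2.2.2) :=
    .pair .fst <| .pair (hs.comp <| .comp .fst .snd) <|
      .pair (ht.comp <| .comp .fst <| .comp .snd .snd) (hu.comp <| .comp .snd <| .comp .snd .snd)
  obtain ⟨_, hf⟩ := hP.comp hstu
  refine ⟨_, hf, fun e => ?_⟩
  simp only [Set.mem_ofPred_eq, decide_eq_true_eq, hs_surj.forall, ht_surj.exists, hu_surj.forall]

end OracleComputability

section TopologicalDynamics

/-- The weak form of microtransitivity (Ancel, van Mill): near every point `z`, the translates of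
`z` by the elements of any given neighbourhood of `1` are dense in a neighbourhood of `z`. -/
def IsWeaklyMicrotransitive (G Z : Type*) [Group G] [MulAction G Z] [TopologicalSpace G]
    [TopologicalSpace Z] : Prop :=
  ∀ V ∈ 𝓝 (1 : G), ∀ z : Z, closure (V • {z}) ∈ 𝓝 z

variable {G Z : Type*} [Group G] [MulAction G Z]

theorem isWeaklyMicrotransitive_of_isPretransitive [TopologicalSpace G] [TopologicalSpace Z]
    [IsTopologicalGroup G] [SecondCountableTopology G] [BaireSpace Z] [ContinuousConstSMul G Z]
    [IsPretransitive G Z] : IsWeaklyMicrotransitive G Z := by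
  intro V hV z
  obtain ⟨W, hW, -, hW_inv, hWV⟩ := exists_closed_nhds_one_inv_eq_mul_subset hV
  obtain ⟨s, hs, hs_cover⟩ : ∃ s : Set G, s.Countable ∧ ⋃ g ∈ s, g • W = Set.univ :=
    countable_cover_nhds fun g => by simpa
  have hW_closure : (interior (closure (W • {z}))).Nonempty := by
    have : Nonempty Z := ⟨z⟩
    have : Countable s := hs
    obtain ⟨g, hg⟩ : ∃ g : s, (interior (closure ((g : G) • W • {z}))).Nonempty := by
      refine nonempty_interior_of_iUnion_of_closed (fun _ => isClosed_closure) ?_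
      refine Set.eq_univ_of_forall fun y => ?_
      obtain ⟨h, rfl⟩ := exists_smul_eq G z y
      obtain ⟨g, hg, hh⟩ := Set.mem_iUnion₂.1 (hs_cover.ge (Set.mem_univ h))
      refine Set.mem_iUnion.2 ⟨⟨g, hg⟩, subset_closure ?_⟩
      rw [← smul_assoc]
      exact Set.smul_mem_smul hh rfl
    rwa [closure_smul, interior_smul, Set.smul_set_nonempty] at hg
  obtain ⟨w, hw, hwz⟩ : ∃ w ∈ W, w • z ∈ interior (closure (W • {z})) := by
    obtain ⟨y, hy⟩ := hW_closure
    simpa only [Set.smul_singleton, Set.inter_nonempty, Set.exists_mem_image, and_comm] using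
      mem_closure_iff.1 (interior_subset hy) _ isOpen_interior hy
  have hz : w⁻¹ • closure (W • {z}) ∈ 𝓝 z := by
    rwa [← smul_mem_nhds_smul_iff w, smul_inv_smul, ← mem_interior_iff_mem_nhds]
  refine mem_of_superset hz ?_
  rw [← closure_smul, ← smul_assoc]
  refine closure_mono (Set.smul_subset_smul_right ((Set.smul_set_subset_mul ?_).trans hWV))
  rwa [← hW_inv, Set.inv_mem_inv]

theorem mem_closure_orbit_trans [TopologicalSpace Z] [ContinuousConstSMul G Z] {x y z : Z}
    (hxy : x ∈ closure (orbit G y)) (hyz : y ∈ closure (orbit G z)) : x ∈ closure (orbit G z) := by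
  refine closure_minimal ?_ isClosed_closure hxy
  rintro _ ⟨g, rfl⟩
  exact smul_closure_orbit_subset g z (Set.smul_mem_smul_set hyz)

section Subgroup

instance continuousConstSMul_subgroup [TopologicalSpace Z] [ContinuousConstSMul G Z]
    (V : Subgroup G) : ContinuousConstSMul V Z :=
  ⟨fun v => continuous_const_smul (v : G)⟩

variable [TopologicalSpace G] {V : Subgroup G}

theorem IsWeaklyMicrotransitive.closure_orbit_mem_nhds [TopologicalSpace Z]
    (h : IsWeaklyMicrotransitive G Z) (hV : (V : Set G) ∈ 𝓝 1) (z : Z) :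
    closure (orbit V z) ∈ 𝓝 z := by
  convert h V hV z
  ext; simp [mem_orbit_iff, Subgroup.smul_def]

theorem IsWeaklyMicrotransitive.mem_closure_orbit_symm [TopologicalSpace Z]
    [ContinuousConstSMul G Z] (h : IsWeaklyMicrotransitive G Z) (hV : (V : Set G) ∈ 𝓝 1) {x y : Z}
    (hxy : x ∈ closure (orbit V y)) : y ∈ closure (orbit V x) := by
  obtain ⟨_, hv, v, rfl⟩ := mem_closure_iff_nhds.1 hxy _ (h.closure_orbit_mem_nhds hV x)
  exact mem_closure_orbit_trans (subset_closure ⟨v⁻¹, inv_smul_smul v y⟩) hv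

theorem IsWeaklyMicrotransitive.exists_forall_dist_lt [PseudoMetricSpace Z] [CompactSpace Z]
    [ContinuousConstSMul G Z] (h : IsWeaklyMicrotransitive G Z) (hV : (V : Set G) ∈ 𝓝 1) :
    ∃ δ > 0, ∀ x y : Z, dist x y < δ → x ∈ closure (orbit V y) := by
  obtain ⟨δ, hδ, hball⟩ := lebesgue_number_lemma_of_metric (isCompact_univ (X := Z))
    (c := fun z => interior (closure (orbit V z))) (fun _ => isOpen_interior)
    fun z _ => Set.mem_iUnion.2 ⟨z, mem_interior_iff_mem_nhds.2 (h.closure_orbit_mem_nhds hV z)⟩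
  refine ⟨δ, hδ, fun x y hxy => ?_⟩
  obtain ⟨z, hz⟩ := hball y trivial
  have hx : x ∈ closure (orbit V z) := interior_subset (hz hxy)
  have hy : y ∈ closure (orbit V z) := interior_subset (hz (Metric.mem_ball_self hδ))
  exact mem_closure_orbit_trans hx (h.mem_closure_orbit_symm hV hy)

end Subgroup

theorem IsWeaklyMicrotransitive.exists_smul_mem_inter_closure [TopologicalSpace G]
    [TopologicalSpace Z] (h : IsWeaklyMicrotransitive G Z) {V : Set G} {a b : Z}
    (hab : a ∈ closure (V • {b})) {U : Set Z} (hU : U ∈ 𝓝 a) {E : Set G} (hE : E ∈ 𝓝 1) :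
    ∃ v ∈ V, v • b ∈ U ∩ closure (E • {a}) := by
  rw [Set.smul_singleton] at hab
  obtain ⟨_, hmem, v, hv, rfl⟩ := mem_closure_iff_nhds.1 hab _ (inter_mem hU (h E hE a))
  exact ⟨v, hv, hmem⟩

section BackAndForth

variable [PseudoMetricSpace G] [ContinuousMul G] [PseudoMetricSpace Z]

theorem setOf_dist_mul_lt_mem_nhds_one (g : G) {ε : ℝ} (hε : 0 < ε) :
    {v : G | dist (v * g) g < ε} ∈ 𝓝 1 :=
  (continuous_mul_const g).continuousAt.preimage_mem_nhds (t := Metric.ball g ε)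
    (by simpa only [one_mul] using Metric.ball_mem_nhds g hε)

theorem IsWeaklyMicrotransitive.exists_back_and_forth (h : IsWeaklyMicrotransitive G Z) {x y : Z}
    {g k : G} {ε η : ℝ} (hε : 0 < ε) (hη : 0 < η)
    (hgk : k • y ∈ closure ({v : G | dist (v * g) g < ε} • {g • x})) :
    ∃ g' k' : G, dist g' g < ε ∧ dist k' k < ε ∧ dist (k' • y) (g' • x) < ε ∧
      k' • y ∈ closure ({v : G | dist (v * g') g' < η} • {g' • x}) := by
  obtain ⟨v, hv, -, hvx⟩ := h.exists_smul_mem_inter_closure hgk univ_mem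
    (setOf_dist_mul_lt_mem_nhds_one k hε)
  obtain ⟨w, hw, hdist, hwy⟩ := h.exists_smul_mem_inter_closure hvx (Metric.ball_mem_nhds _ hε)
    (setOf_dist_mul_lt_mem_nhds_one (v * g) hη)
  rw [smul_smul, smul_smul] at hdist hwy
  exact ⟨v * g, w * k, hv, hw, hdist, hwy⟩

theorem IsWeaklyMicrotransitive.exists_seq_dist_smul_lt [IsMinimal G Z]
    (h : IsWeaklyMicrotransitive G Z) (x y : Z) :
    ∃ g k : ℕ → G, (∀ n, dist (g (n + 1)) (g n) < (1 / 2) ^ n) ∧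
      (∀ n, dist (k (n + 1)) (k n) < (1 / 2) ^ n) ∧
      ∀ n, dist (k (n + 1) • y) (g (n + 1) • x) < (1 / 2) ^ n := by
  have hpos (n : ℕ) : (0 : ℝ) < (1 / 2) ^ n := by positivity
  let P (n : ℕ) (p : G × G) : Prop :=
    p.2 • y ∈ closure ({v : G | dist (v * p.1) p.1 < (1 / 2) ^ n} • {p.1 • x})
  obtain ⟨k₀, hk₀⟩ : ∃ k₀, P 0 (1, k₀) := by
    obtain ⟨_, hk, k, rfl⟩ := mem_closure_iff_nhds.1 (dense_orbit G y x) _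
      (h _ (setOf_dist_mul_lt_mem_nhds_one 1 (hpos 0)) x)
    exact ⟨k, by simpa only [P, one_smul] using hk⟩
  choose! g' k' hg' hk' hdist hP using fun n (p : G × G) (hp : P n p) =>
    h.exists_back_and_forth (hpos n) (hpos (n + 1)) hp
  let s : ℕ → G × G := fun n => n.rec (1, k₀) fun n p => (g' n p, k' n p)
  have hs (n : ℕ) : P n (s n) := by
    induction n with
    | zero => exact hk₀
    | succ n ih => exact hP n _ ih
  exact ⟨fun n => (s n).1, fun n => (s n).2, fun n => hg' n _ (hs n), fun n => hk' n _ (hs n),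
    fun n => hdist n _ (hs n)⟩

end BackAndForth

theorem exists_tendsto_of_dist_lt_geometric {α : Type*} [PseudoMetricSpace α] [CompleteSpace α]
    {s : ℕ → α} (hs : ∀ n, dist (s (n + 1)) (s n) < (1 / 2) ^ n) : ∃ a, Tendsto s atTop (𝓝 a) :=
  cauchySeq_tendsto_of_complete <| cauchySeq_of_le_geometric (1 / 2) 1 one_half_lt_one fun n => by
    simpa only [one_mul, dist_comm] using (hs n).le

theorem IsWeaklyMicrotransitive.isPretransitive [TopologicalSpace G] [ContinuousMul G]
    [TopologicalSpace.IsCompletelyMetrizableSpace G] [MetricSpace Z] [ContinuousSMul G Z]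
    [IsMinimal G Z] (h : IsWeaklyMicrotransitive G Z) : IsPretransitive G Z := by
  let := TopologicalSpace.upgradeIsCompletelyMetrizable G
  refine ⟨fun x y => ?_⟩
  obtain ⟨g, k, hg, hk, hgk⟩ := h.exists_seq_dist_smul_lt x y
  obtain ⟨g', hg'⟩ := exists_tendsto_of_dist_lt_geometric hg
  obtain ⟨k', hk'⟩ := exists_tendsto_of_dist_lt_geometric hk
  have hdist : Tendsto (fun n => dist (k (n + 1) • y) (g (n + 1) • x)) atTop (𝓝 0) :=
    squeeze_zero (fun _ => dist_nonneg) (fun n => (hgk n).le)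
      (tendsto_pow_atTop_nhds_zero_of_lt_one one_half_pos.le one_half_lt_one)
  have hlim : Tendsto (fun n => dist (k (n + 1) • y) (g (n + 1) • x)) atTop
      (𝓝 (dist (k' • y) (g' • x))) :=
    (((hk'.smul_const y).dist (hg'.smul_const x)).comp (tendsto_add_atTop_nat 1))
  have heq : k' • y = g' • x := dist_eq_zero.1 (tendsto_nhds_unique hlim hdist)
  exact ⟨k'⁻¹ * g', by rw [mul_smul, ← heq, inv_smul_smul]⟩

end TopologicalDynamics

section PermutationGroups

theorem continuous_perm_apply (k : ℕ) : Continuous fun g : Equiv.Perm ℕ => g k :=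
  (continuous_apply k).comp continuous_induced_dom

theorem continuous_perm_inv_apply (k : ℕ) : Continuous fun g : Equiv.Perm ℕ => g⁻¹ k := by
  refine continuous_discrete_rng.2 fun m => ?_
  convert (isOpen_discrete {k}).preimage (continuous_perm_apply m) using 1
  ext g
  exact Equiv.Perm.inv_eq_iff_eq.trans eq_comm

theorem continuous_eval_nat : Continuous fun p : (ℕ → ℕ) × ℕ => p.1 p.2 :=
  continuous_prod_of_discrete_right.2 continuous_apply

instance isTopologicalGroup_perm : IsTopologicalGroup (Equiv.Perm ℕ) where
  continuous_mul := continuous_induced_rng.2 <| continuous_pi fun k =>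
    continuous_eval_nat.comp <| .prodMk
      ((continuous_pi continuous_perm_apply).comp continuous_fst)
      ((continuous_perm_apply k).comp continuous_snd)
  continuous_inv := continuous_induced_rng.2 <| continuous_pi continuous_perm_inv_apply

theorem isClosedEmbedding_perm :
    IsClosedEmbedding fun g : Equiv.Perm ℕ => ((g : ℕ → ℕ), ((g⁻¹ : Equiv.Perm ℕ) : ℕ → ℕ)) := by
  have hcont :
      Continuous fun g : Equiv.Perm ℕ => ((g : ℕ → ℕ), ((g⁻¹ : Equiv.Perm ℕ) : ℕ → ℕ)) :=
    (continuous_pi continuous_perm_apply).prodMk (continuous_pi continuous_perm_inv_apply)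
  refine ⟨⟨IsInducing.of_comp hcont continuous_fst ⟨rfl⟩, fun f g h =>
    DFunLike.coe_injective (congrArg Prod.fst h)⟩, ?_⟩
  have hrange : Set.range (fun g : Equiv.Perm ℕ => ((g : ℕ → ℕ), ((g⁻¹ : Equiv.Perm ℕ) : ℕ → ℕ))) =
      ⋂ k, {p : (ℕ → ℕ) × (ℕ → ℕ) | p.1 (p.2 k) = k} ∩ {p | p.2 (p.1 k) = k} := by
    ext p
    constructor
    · rintro ⟨g, rfl⟩
      simp
    · intro hp
      rw [Set.mem_iInter] at hp
      exact ⟨⟨p.1, p.2, fun k => (hp k).2, fun k => (hp k).1⟩, rfl⟩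
  rw [hrange]
  refine isClosed_iInter fun k => IsClosed.inter ?_ ?_
  · exact isClosed_eq (continuous_eval_nat.comp <| continuous_fst.prodMk <|
      (continuous_apply k).comp continuous_snd) continuous_const
  · exact isClosed_eq (continuous_eval_nat.comp <| continuous_snd.prodMk <|
      (continuous_apply k).comp continuous_fst) continuous_const

instance polishSpace_perm : PolishSpace (Equiv.Perm ℕ) :=
  isClosedEmbedding_perm.polishSpace

variable {G : Subgroup (Equiv.Perm ℕ)}

theorem mem_fixingSubgroup_coe_finset {D : Finset ℕ} {g : G} :
    g ∈ fixingSubgroup G (D : Set ℕ) ↔ ∀ k ∈ D, (g : Equiv.Perm ℕ) k = k :=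
  mem_fixingSubgroup_iff G

theorem mem_basicSubgroups {U : Set G} :
    U ∈ basicSubgroups G ↔ ∃ D : Finset ℕ, U = fixingSubgroup G (D : Set ℕ) := by
  simp only [basicSubgroups, Set.mem_ofPred_eq, Set.ext_iff, SetLike.mem_coe,
    mem_fixingSubgroup_coe_finset]

theorem basicSubgroups_subset_basicSets : basicSubgroups G ⊆ basicSets G := by
  rintro U ⟨D, rfl⟩
  exact ⟨1, D, rfl⟩

theorem hasBasis_nhds_one_fixingSubgroup :
    (𝓝 (1 : G)).HasBasis (fun _ : Finset ℕ => True)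
      fun D => (fixingSubgroup G (D : Set ℕ) : Set G) := by
  have hind : IsInducing fun g : G => ((g : Equiv.Perm ℕ) : ℕ → ℕ) :=
    (IsInducing.mk rfl).comp IsInducing.subtypeVal
  have hpure : 𝓝 (1 : G) = comap (fun g : G => ((g : Equiv.Perm ℕ) : ℕ → ℕ)) (Filter.pi pure) := by
    rw [hind.nhds_eq_comap, nhds_pi, nhds_discrete]
    rfl
  rw [hpure]
  refine ((hasBasis_pi_pure id).comap _).to_hasBasis (fun D hD => ?_) fun D _ => ?_
  · exact ⟨hD.toFinset, trivial, fun g hg k hk => hg ⟨k, by simpa using hk⟩⟩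
  · exact ⟨D, D.finite_toSet, fun g hg => mem_fixingSubgroup_coe_finset.2 hg⟩

theorem isOpen_fixingSubgroup (D : Finset ℕ) :
    IsOpen (fixingSubgroup G (D : Set ℕ) : Set G) :=
  Subgroup.isOpen_of_mem_nhds _ (hasBasis_nhds_one_fixingSubgroup.mem_of_mem trivial)

end PermutationGroups

section VaughtTransforms

variable {G : Subgroup (Equiv.Perm ℕ)} {X : Type*} [MulAction G X]

theorem mem_vaughtStar_compl [TopologicalSpace X] [ContinuousSMul G X] {A : Set X} (hA : IsOpen A)
    {H : Set G} [BaireSpace H] {x : X} : x ∈ vaughtStar Aᶜ H ↔ ∀ g ∈ H, g • x ∉ A := by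
  have hopen : IsOpen {h : H | (h : G) • x ∈ A} :=
    hA.preimage (by fun_prop)
  constructor
  · intro hx g hg hgx
    refine not_isMeagre_of_isOpen hopen ⟨⟨g, hg⟩, hgx⟩ ?_
    exact hx
  · intro hx
    change {h : H | (h : G) • x ∈ Aᶜ} ∈ residual H
    exact univ_mem' fun h => hx h h.2

end VaughtTransforms

section CanonicalPieces

variable {G : Subgroup (Equiv.Perm ℕ)} {X : Type*} [MulAction G X]

theorem mem_saturation {A : Set X} {x : X} : x ∈ saturation G A ↔ ∃ g : G, g • x ∈ A := by
  simp only [saturation, Set.mem_iUnion, Set.mem_smul_set_iff_inv_smul_mem]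
  exact (Equiv.inv G).exists_congr_left.trans (by simp)

theorem smul_mem_saturation_iff {A : Set X} (g : G) {x : X} :
    g • x ∈ saturation G A ↔ x ∈ saturation G A := by
  simp only [mem_saturation, smul_smul]
  exact (Equiv.mulRight g).exists_congr_left.trans (by simp)

namespace IsCanonicalPiece

variable {𝒜 : Set (Set X)} {Y Z : Set X}

theorem mem_iff (hY : IsCanonicalPiece G 𝒜 Y) {x : X} :
    x ∈ Y ↔ ∀ A ∈ 𝒜, x ∈ saturation G A ↔ Y ⊆ saturation G A := by
  obtain ⟨⟨y, hy⟩, T, hT, hYT⟩ := hY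
  have hmem (z : X) : z ∈ Y ↔ ∀ A ∈ 𝒜, z ∈ saturation G A ↔ A ∈ T := by
    simp only [hYT, Set.mem_inter_iff, Set.mem_iInter, Set.mem_compl_iff, Set.mem_sdiff]
    constructor
    · rintro ⟨h_in, h_notin⟩ A hA
      exact ⟨fun h => by_contra fun hAT => h_notin A ⟨hA, hAT⟩ h, h_in A⟩
    · exact fun h => ⟨fun A hA => (h A (hT hA)).2 hA, fun A hA hz => hA.2 ((h A hA.1).1 hz)⟩
  have hsub {A : Set X} (hA : A ∈ 𝒜) : Y ⊆ saturation G A ↔ A ∈ T :=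
    ⟨fun h => ((hmem y).1 hy A hA).1 (h hy), fun h z hz => ((hmem z).1 hz A hA).2 h⟩
  rw [hmem]
  exact forall₂_congr fun A hA => by rw [hsub hA]

theorem eq_of_forall_subset_saturation_iff (hY : IsCanonicalPiece G 𝒜 Y)
    (hZ : IsCanonicalPiece G 𝒜 Z)
    (h : ∀ A ∈ 𝒜, Y ⊆ saturation G A ↔ Z ⊆ saturation G A) : Y = Z := by
  ext x
  rw [hY.mem_iff, hZ.mem_iff]
  exact forall₂_congr fun A hA => by rw [h A hA]

theorem eq_of_codes {νA : FamilyNumbering 𝒜} {e : ℕ} (hY : IsCanonicalPiece G 𝒜 Y)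
    (hZ : IsCanonicalPiece G 𝒜 Z) (hYe : Codes (G := G) νA e Y) (hZe : Codes (G := G) νA e Z) :
    Y = Z := by
  refine hY.eq_of_forall_subset_saturation_iff hZ fun A hA => ?_
  obtain ⟨n, hn, rfl⟩ := νA.bijOn.surjOn hA
  have := Part.some_injective ((hYe n).symm.trans (hZe n))
  split_ifs at this <;> tauto

theorem conRel_iff {ℬ : Set (Set X)} {νA : FamilyNumbering 𝒜} {νB : FamilyNumbering ℬ} {e b : ℕ}
    (hY : IsCanonicalPiece G 𝒜 Y) (hYe : Codes (G := G) νA e Y) (hb : b ∈ νB.dom) :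
    ConRel G νA νB e b ↔ (νB.val b ∩ Y).Nonempty := by
  constructor
  · rintro ⟨-, Z, hZ, hne, hZe⟩
    rwa [hY.eq_of_codes hZ hYe hZe]
  · exact fun hne => ⟨hb, Y, hY, hne, hYe⟩

theorem smul_mem (hY : IsCanonicalPiece G 𝒜 Y) (g : G) {x : X} (hx : x ∈ Y) : g • x ∈ Y :=
  hY.mem_iff.2 fun A hA => (smul_mem_saturation_iff g).trans (hY.mem_iff.1 hx A hA)

/-- A canonical piece as a `G`-space. -/
def toSubMulAction (hY : IsCanonicalPiece G 𝒜 Y) : SubMulAction G X where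
  carrier := Y
  smul_mem' g _ hx := hY.smul_mem g hx

theorem isMinimal_toSubMulAction [TopologicalSpace X]
    (h𝒜 : TopologicalSpace.IsTopologicalBasis 𝒜) (hY : IsCanonicalPiece G 𝒜 Y) :
    IsMinimal G hY.toSubMulAction := by
  refine ⟨fun x y => (h𝒜.isInducing .subtypeVal).mem_closure_iff.2 ?_⟩
  rintro _ ⟨A, hA, rfl⟩ hyA
  have hsub : Y ⊆ saturation G A :=
    (hY.mem_iff.1 y.2 A hA).1 (mem_saturation.2 ⟨1, by rwa [one_smul]⟩)
  obtain ⟨g, hg⟩ := mem_saturation.1 (hsub x.2)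
  exact ⟨g • x, hg, mem_orbit x g⟩

end IsCanonicalPiece

theorem exists_eq_orbit_iff_isPretransitive {G X : Type*} [Group G] [MulAction G X]
    {S : SubMulAction G X} (hS : (S : Set X).Nonempty) :
    (∃ x, (S : Set X) = orbit G x) ↔ IsPretransitive G S := by
  obtain ⟨x, hx⟩ := hS
  constructor
  · rintro ⟨z, hz⟩
    refine ⟨fun a b => ?_⟩
    obtain ⟨g, hg : g • z = a⟩ := hz.le a.2
    obtain ⟨h, hh : h • z = b⟩ := hz.le b.2
    exact ⟨h * g⁻¹, Subtype.ext <| by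
      rw [SubMulAction.val_smul, ← hg, ← hh, smul_smul, inv_mul_cancel_right]⟩
  · intro h
    refine ⟨x, Set.Subset.antisymm (fun y hy => ?_) ?_⟩
    · obtain ⟨g, hg⟩ := exists_smul_eq G (⟨x, hx⟩ : S) ⟨y, hy⟩
      exact ⟨g, congrArg Subtype.val hg⟩
    · rintro _ ⟨g, rfl⟩
      exact S.smul_mem g hx

end CanonicalPieces

section SmallClopenSets

variable {X : Type*} {𝒜 : Set (Set X)}

theorem exists_isClopen_diamLT_of_isTopologicalBasis [PseudoMetricSpace X]
    (h𝒜 : TopologicalSpace.IsTopologicalBasis {A ∈ 𝒜 | IsClopen A}) (x : X) (i : ℕ) :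
    ∃ A ∈ 𝒜, IsClopen A ∧ x ∈ A ∧ DiamLT (fun x y => dist x y) A i := by
  have hpos : (0 : ℝ) < (1 / 2) ^ i := by positivity
  obtain ⟨A, ⟨hA, hA_clopen⟩, hxA, hA_ball⟩ :=
    h𝒜.mem_nhds_iff.1 (Metric.ball_mem_nhds x (ε := (1 / 2) ^ i / 4) (by positivity))
  refine ⟨A, hA, hA_clopen, hxA, (1 / 2) ^ i / 2, half_lt_self hpos, fun y hy z hz => ?_⟩
  have hyx : dist y x < (1 / 2) ^ i / 4 := hA_ball hy
  have hzx : dist z x < (1 / 2) ^ i / 4 := hA_ball hz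
  linarith [dist_triangle_right y z x]

theorem IsAdmissibleBasis.isTopologicalBasis_isClopen [TopologicalSpace X]
    {G : Subgroup (Equiv.Perm ℕ)} [MulAction G X] (h𝒜 : IsAdmissibleBasis G 𝒜) :
    TopologicalSpace.IsTopologicalBasis {A ∈ 𝒜 | IsClopen A} := by
  have hbasis := TopologicalSpace.isTopologicalBasis_of_subbasis_of_inter h𝒜.clopen_generate.symm
    fun A₁ h₁ A₂ h₂ => ⟨h𝒜.inter_mem A₁ h₁.1 A₂ h₂.1, h₁.2.inter h₂.2⟩
  refine TopologicalSpace.isTopologicalBasis_of_isOpen_of_nhds (fun A hA => hA.2.isOpen)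
    fun x U hxU hU => ?_
  obtain ⟨A, hA, hxA, hAU⟩ := h𝒜.basis.exists_subset_of_mem_open hxU hU
  obtain ⟨B, hB, hxB, hBA⟩ := hbasis.exists_subset_of_mem_open hxA (h𝒜.basis.isOpen hA)
  obtain rfl | hB := hB
  · obtain rfl := Set.univ_subset_iff.1 hBA
    exact ⟨_, ⟨hA, isClopen_univ⟩, hxA, hAU⟩
  · exact ⟨B, hB, hxB, hBA.trans hAU⟩

end SmallClopenSets

section UniformMicrotransitivity

variable {G : Subgroup (Equiv.Perm ℕ)} {X : Type*} [MetricSpace X] [MulAction G X]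
  {𝒜 : Set (Set X)}

/-- Weak microtransitivity of the action on `Y`, uniformly in the points of `Y`, as it can be
expressed by the members of `𝒜`: the translates of any point of `Y` by a basic subgroup are dense
in the part of `Y` lying in any clopen set around the point which is small enough. -/
def IsUniformlyWeaklyMicrotransitiveOn (G : Subgroup (Equiv.Perm ℕ)) {X : Type*} [MetricSpace X]
    [MulAction G X] (𝒜 : Set (Set X)) (Y : Set X) : Prop :=
  ∀ D : Finset ℕ, ∃ i : ℕ, ∀ A ∈ 𝒜, IsClopen A → DiamLT (fun x y => dist x y) A i →
    ∀ A' ∈ 𝒜, (A ∩ A' ∩ Y).Nonempty →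
      ∀ w ∈ A ∩ Y, ∃ g ∈ fixingSubgroup G (D : Set ℕ), g • w ∈ A'

theorem IsUniformlyWeaklyMicrotransitiveOn.isWeaklyMicrotransitive {S : SubMulAction G X}
    (h𝒜 : TopologicalSpace.IsTopologicalBasis {A ∈ 𝒜 | IsClopen A})
    (hS : IsUniformlyWeaklyMicrotransitiveOn G 𝒜 (S : Set X)) : IsWeaklyMicrotransitive G S := by
  intro V hV z
  obtain ⟨D, -, hDV⟩ := hasBasis_nhds_one_fixingSubgroup.mem_iff.1 hV
  obtain ⟨i, hi⟩ := hS D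
  obtain ⟨A, hA, hA_clopen, hzA, hA_small⟩ := exists_isClopen_diamLT_of_isTopologicalBasis h𝒜 z i
  have hA_nhds : ((↑) : S → X) ⁻¹' A ∈ 𝓝 z :=
    (hA_clopen.isOpen.preimage continuous_subtype_val).mem_nhds hzA
  refine mem_of_superset hA_nhds fun w hwA => (h𝒜.isInducing .subtypeVal).mem_closure_iff.2 ?_
  rintro _ ⟨A', ⟨hA', -⟩, rfl⟩ hwA'
  obtain ⟨g, hg, hgz⟩ :=
    hi A hA hA_clopen hA_small A' hA' ⟨w, ⟨hwA, hwA'⟩, w.2⟩ z ⟨hzA, z.2⟩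
  exact ⟨g • z, hgz, Set.smul_mem_smul (hDV hg) rfl⟩

variable [ContinuousSMul G X]

theorem IsUniformlyWeaklyMicrotransitiveOn.isPretransitive [PolishSpace G] {S : SubMulAction G X}
    [IsMinimal G S] (h𝒜 : TopologicalSpace.IsTopologicalBasis {A ∈ 𝒜 | IsClopen A})
    (hS : IsUniformlyWeaklyMicrotransitiveOn G 𝒜 (S : Set X)) : IsPretransitive G S :=
  (hS.isWeaklyMicrotransitive h𝒜).isPretransitive

theorem isUniformlyWeaklyMicrotransitiveOn_of_isCompact {S : SubMulAction G X}
    (h_open : ∀ A ∈ 𝒜, IsOpen A) (hS : IsCompact (S : Set X)) [IsPretransitive G S] :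
    IsUniformlyWeaklyMicrotransitiveOn G 𝒜 (S : Set X) := by
  intro D
  have : CompactSpace S := isCompact_iff_compactSpace.1 hS
  have : SecondCountableTopology G := IsInducing.subtypeVal.secondCountableTopology
  have h : IsWeaklyMicrotransitive G S := isWeaklyMicrotransitive_of_isPretransitive
  obtain ⟨δ, hδ, hdist⟩ :=
    h.exists_forall_dist_lt ((isOpen_fixingSubgroup D).mem_nhds (one_mem _))
  obtain ⟨i, hi⟩ := exists_pow_lt_of_lt_one hδ one_half_lt_one
  refine ⟨i, fun A _ _ ⟨r, hr, hA_small⟩ A' hA' ⟨v, ⟨hvA, hvA'⟩, hv⟩ w ⟨hwA, hw⟩ => ?_⟩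
  have hvw : (⟨v, hv⟩ : S) ∈ closure (orbit (fixingSubgroup G (D : Set ℕ)) (⟨w, hw⟩ : S)) :=
    hdist _ _ ((hA_small v hvA w hwA).trans_lt (hr.trans hi))
  obtain ⟨_, hgw, g, rfl⟩ := mem_closure_iff.1 hvw _
    ((h_open A' hA').preimage continuous_subtype_val) hvA'
  exact ⟨g, g.2, hgw⟩

end UniformMicrotransitivity

section Numberings

theorem FamilyNumbering.exists_val_eq {α : Type*} {𝒞 : Set α} (ν : FamilyNumbering 𝒞) {C : α}
    (hC : C ∈ 𝒞) : ∃ n ∈ ν.dom, ν.val n = C :=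
  ν.bijOn.surjOn hC

theorem FamilyNumbering.val_mem {α : Type*} {𝒞 : Set α} (ν : FamilyNumbering 𝒞) {n : ℕ}
    (hn : n ∈ ν.dom) : ν.val n ∈ 𝒞 :=
  ν.bijOn.mapsTo hn

/-- A family of sets closed under finite intersections, complements and the Vaught transforms
`B ↦ B^{*u}` for `u ∈ 𝒩^G`: the closure properties of a nice basis. -/
structure IsVaughtAlgebra (G : Subgroup (Equiv.Perm ℕ)) {X : Type*} [MulAction G X]
    (ℬ : Set (Set X)) : Prop where
  inter_mem : ∀ B₁ ∈ ℬ, ∀ B₂ ∈ ℬ, B₁ ∩ B₂ ∈ ℬ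
  compl_mem : ∀ B ∈ ℬ, Bᶜ ∈ ℬ
  vaughtStar_mem : ∀ B ∈ ℬ, ∀ u ∈ basicSets G, vaughtStar B u ∈ ℬ

theorem IsNiceBasis.isVaughtAlgebra {G : Subgroup (Equiv.Perm ℕ)} {X : Type*} [MulAction G X]
    [TopologicalSpace X] {ℬ : Set (Set X)} (hℬ : IsNiceBasis G ℬ) : IsVaughtAlgebra G ℬ := by
  obtain ⟨_, -, -, -, -, -, h_inter, h_compl, h_star, -⟩ := hℬ
  exact ⟨h_inter, h_compl, h_star⟩

variable {G : Subgroup (Equiv.Perm ℕ)} {X : Type*} [MetricSpace X] [MulAction G X]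
  {𝒜 ℬ : Set (Set X)} {νN : FamilyNumbering (basicSets G)} {νA : FamilyNumbering 𝒜}
  {νB : FamilyNumbering ℬ} {f : ℕ → ℕ}

/-- The numbers describe an instance of uniform weak microtransitivity for the basic subgroup `V`
numbered by `v`, a clopen set `A` of diameter less than `2^(-i)` numbered by `a`, and `A' ∈ 𝒜`
numbered by `a'`: then `k` is the number of `A ∩ A'` in `ℬ`, `c` is that of the complement of `A'`,
`s` that of its Vaught transform `(A'ᶜ)^{*V}`, and `m` that of `A ∩ (A'ᶜ)^{*V}`. Here `f`
translates the numbers in `𝒜` to numbers in `ℬ`. -/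
structure IsLocalTest (νN : FamilyNumbering (basicSets G)) (νA : FamilyNumbering 𝒜)
    (νB : FamilyNumbering ℬ) (f : ℕ → ℕ) (v i a a' k c s m : ℕ) : Prop where
  subgroup : v ∈ νN.dom ∧ νN.val v ∈ basicSubgroups G
  small : a ∈ νA.dom ∧ IsClopen (νA.val a) ∧ DiamLT (fun x y : X => dist x y) (νA.val a) i
  target : a' ∈ νA.dom
  inter : f a ∈ νB.dom ∧ f a' ∈ νB.dom ∧ k ∈ νB.dom ∧ νB.val (f a) ∩ νB.val (f a') = νB.val k
  compl : f a' ∈ νB.dom ∧ c ∈ νB.dom ∧ νB.val c = (νB.val (f a'))ᶜ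
  star : c ∈ νB.dom ∧ v ∈ νN.dom ∧ s ∈ νB.dom ∧ vaughtStar (νB.val c) (νN.val v) = νB.val s
  avoid : f a ∈ νB.dom ∧ s ∈ νB.dom ∧ m ∈ νB.dom ∧ νB.val (f a) ∩ νB.val s = νB.val m

theorem baireSpace_of_mem_basicSubgroups [PolishSpace G] {V : Set G} (hV : V ∈ basicSubgroups G) :
    BaireSpace V := by
  obtain ⟨D, rfl⟩ := mem_basicSubgroups.1 hV
  exact (isOpen_fixingSubgroup D).baireSpace

namespace IsLocalTest

variable {v i a a' k c s m : ℕ}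

theorem val_inter (h : IsLocalTest νN νA νB f v i a a' k c s m)
    (hf : ∀ n ∈ νA.dom, f n ∈ νB.dom ∧ νB.val (f n) = νA.val n) :
    νB.val k = νA.val a ∩ νA.val a' := by
  rw [← (hf a h.small.1).2, ← (hf a' h.target).2, h.inter.2.2.2]

theorem mem_val_avoid [PolishSpace G] [ContinuousSMul G X] (h_open : ∀ A ∈ 𝒜, IsOpen A)
    (h : IsLocalTest νN νA νB f v i a a' k c s m)
    (hf : ∀ n ∈ νA.dom, f n ∈ νB.dom ∧ νB.val (f n) = νA.val n) {w : X} :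
    w ∈ νB.val m ↔ w ∈ νA.val a ∧ ∀ g ∈ νN.val v, g • w ∉ νA.val a' := by
  have := baireSpace_of_mem_basicSubgroups h.subgroup.2
  rw [← h.avoid.2.2.2, ← h.star.2.2.2, h.compl.2.2, (hf a h.small.1).2, (hf a' h.target).2,
    Set.mem_inter_iff, mem_vaughtStar_compl (h_open _ (νA.val_mem h.target))]

end IsLocalTest

theorem IsVaughtAlgebra.exists_isLocalTest (hℬ : IsVaughtAlgebra G ℬ)
    (hf : ∀ n ∈ νA.dom, f n ∈ νB.dom ∧ νB.val (f n) = νA.val n) {v i a a' : ℕ}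
    (hv : v ∈ νN.dom) (hv_sub : νN.val v ∈ basicSubgroups G) (ha : a ∈ νA.dom)
    (ha_clopen : IsClopen (νA.val a)) (ha_small : DiamLT (fun x y : X => dist x y) (νA.val a) i)
    (ha' : a' ∈ νA.dom) : ∃ k c s m, IsLocalTest νN νA νB f v i a a' k c s m := by
  have hfa := (hf a ha).1
  have hfa' := (hf a' ha').1
  obtain ⟨k, hk, hk_val⟩ := νB.exists_val_eq
    (hℬ.inter_mem _ (νB.val_mem hfa) _ (νB.val_mem hfa'))
  obtain ⟨c, hc, hc_val⟩ := νB.exists_val_eq (hℬ.compl_mem _ (νB.val_mem hfa'))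
  obtain ⟨s, hs, hs_val⟩ := νB.exists_val_eq
    (hℬ.vaughtStar_mem _ (νB.val_mem hc) _ (νN.val_mem hv))
  obtain ⟨m, hm, hm_val⟩ := νB.exists_val_eq
    (hℬ.inter_mem _ (νB.val_mem hfa) _ (νB.val_mem hs))
  exact ⟨k, c, s, m, ⟨hv, hv_sub⟩, ⟨ha, ha_clopen, ha_small⟩, ha', ⟨hfa, hfa', hk, hk_val.symm⟩,
    ⟨hfa', hc, hc_val⟩, ⟨hc, hv, hs, hs_val.symm⟩, ⟨hfa, hs, hm, hm_val.symm⟩⟩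

theorem isUniformlyWeaklyMicrotransitiveOn_iff_forall_isLocalTest [PolishSpace G]
    [ContinuousSMul G X] (h_open : ∀ A ∈ 𝒜, IsOpen A) (hℬ : IsVaughtAlgebra G ℬ)
    (hf : ∀ n ∈ νA.dom, f n ∈ νB.dom ∧ νB.val (f n) = νA.val n) {Y : Set X} :
    IsUniformlyWeaklyMicrotransitiveOn G 𝒜 Y ↔
      ∀ v, ∃ i, ∀ a a' k c s m, IsLocalTest νN νA νB f v i a a' k c s m →
        ¬ ((νB.val k ∩ Y).Nonempty ∧ (νB.val m ∩ Y).Nonempty) := by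
  constructor
  · intro hY v
    by_cases hv : νN.val v ∈ basicSubgroups G
    · obtain ⟨D, hD⟩ := mem_basicSubgroups.1 hv
      obtain ⟨i, hi⟩ := hY D
      refine ⟨i, fun a a' k c s m h ⟨hk, w, hwm, hwY⟩ => ?_⟩
      obtain ⟨hwa, hw_avoid⟩ := (h.mem_val_avoid h_open hf).1 hwm
      rw [h.val_inter hf] at hk
      obtain ⟨g, hg, hgw⟩ := hi _ (νA.val_mem h.small.1) h.small.2.1 h.small.2.2 _
        (νA.val_mem h.target) hk w ⟨hwa, hwY⟩
      exact hw_avoid g (hD.ge hg) hgw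
    · exact ⟨0, fun a a' k c s m h => absurd h.subgroup.2 hv⟩
  · intro h D
    have hV : (fixingSubgroup G (D : Set ℕ) : Set G) ∈ basicSubgroups G :=
      mem_basicSubgroups.2 ⟨D, rfl⟩
    obtain ⟨v, hv, hvD⟩ := νN.exists_val_eq (basicSubgroups_subset_basicSets hV)
    obtain ⟨i, hi⟩ := h v
    refine ⟨i, fun A hA hA_clopen hA_small A' hA' hAA' w hw => ?_⟩
    obtain ⟨a, ha, rfl⟩ := νA.exists_val_eq hA
    obtain ⟨a', ha', rfl⟩ := νA.exists_val_eq hA'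
    obtain ⟨k, c, s, m, hq⟩ :=
      hℬ.exists_isLocalTest hf hv (hvD ▸ hV) ha hA_clopen hA_small ha'
    by_contra! hw_avoid
    refine hi a a' k c s m hq ⟨by rwa [hq.val_inter hf], w, ?_, hw.2⟩
    exact (hq.mem_val_avoid h_open hf).2 ⟨hw.1, hvD ▸ hw_avoid⟩

end Numberings

section Complexity

variable {G : Subgroup (Equiv.Perm ℕ)} {X : Type*} [MetricSpace X] [MulAction G X]
  {𝒜 ℬ : Set (Set X)} {νN : FamilyNumbering (basicSets G)} {νA : FamilyNumbering 𝒜}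
  {νB : FamilyNumbering ℬ} {f : ℕ → ℕ} {α : Type*} [Primcodable α] {O : Set (ℕ →. ℕ)}

theorem computablePredIn_isLocalTest (hcomp : IsComputableBasis νN νA νB) (hf : Computable f)
    {v i a a' k c s m : α → ℕ} (hv : Computable v) (hi : Computable i) (ha : Computable a)
    (ha' : Computable a') (hk : Computable k) (hc : Computable c) (hs : Computable s)
    (hm : Computable m) : ComputablePredIn O fun q =>
      IsLocalTest νN νA νB f (v q) (i q) (a q) (a' q) (k q) (c q) (s q) (m q) := by
  have hfa : Computable fun q => f (a q) := hf.comp ha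
  have hfa' : Computable fun q => f (a' q) := hf.comp ha'
  have h_subgroup := (computablePredIn_of_computablePred (O := O)
    hcomp.presentation.basicSubgroup_N).comp hv
  have h_small := (computablePredIn_of_computablePred (O := O)
    hcomp.presentation.diam_A).comp (ha.pair hi)
  have h_target := (computablePredIn_of_computablePred (O := O) νA.dom_computable).comp ha'
  have h_inter := (computablePredIn_of_computablePred (O := O)
    hcomp.inter_B).comp (hfa.pair (hfa'.pair hk))
  have h_compl := (computablePredIn_of_computablePred (O := O) hcomp.compl_B).comp (hfa'.pair hc)
  have h_star := (computablePredIn_of_computablePred (O := O)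
    hcomp.vaughtStar_B).comp (hc.pair (hv.pair hs))
  have h_avoid := (computablePredIn_of_computablePred (O := O)
    hcomp.inter_B).comp (hfa.pair (hs.pair hm))
  convert h_subgroup.and <| h_small.and <| h_target.and <| h_inter.and <| h_compl.and <|
    h_star.and h_avoid using 2 with q
  exact ⟨fun ⟨h₁, h₂, h₃, h₄, h₅, h₆, h₇⟩ => ⟨h₁, h₂, h₃, h₄, h₅, h₆, h₇⟩,
    fun ⟨h₁, h₂, h₃, h₄, h₅, h₆, h₇⟩ => ⟨h₁, h₂, h₃, h₄, h₅, h₆, h₇⟩⟩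

theorem exists_codes_and_isUniformlyWeaklyMicrotransitiveOn_iff [PolishSpace G]
    [ContinuousSMul G X] (h𝒜 : TopologicalSpace.IsTopologicalBasis 𝒜) (hℬ : IsVaughtAlgebra G ℬ)
    (hf : ∀ n ∈ νA.dom, f n ∈ νB.dom ∧ νB.val (f n) = νA.val n) {e : ℕ} :
    (∃ Y, IsCanonicalPiece G 𝒜 Y ∧ Codes (G := G) νA e Y ∧
        IsUniformlyWeaklyMicrotransitiveOn G 𝒜 Y) ↔
      (∃ b, ConRel G νA νB e b) ∧
        ∀ v, ∃ i, ∀ a a' k c s m, IsLocalTest νN νA νB f v i a a' k c s m →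
          ¬ (ConRel G νA νB e k ∧ ConRel G νA νB e m) := by
  have hCon {Y : Set X} (hY : IsCanonicalPiece G 𝒜 Y) (hYe : Codes (G := G) νA e Y) :
      IsUniformlyWeaklyMicrotransitiveOn G 𝒜 Y ↔
        ∀ v, ∃ i, ∀ a a' k c s m, IsLocalTest νN νA νB f v i a a' k c s m →
          ¬ (ConRel G νA νB e k ∧ ConRel G νA νB e m) := by
    rw [isUniformlyWeaklyMicrotransitiveOn_iff_forall_isLocalTest (νN := νN)
      (fun A hA => h𝒜.isOpen hA) hℬ hf]
    refine forall_congr' fun v => exists_congr fun i => ?_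
    refine forall₂_congr fun a a' => forall₄_congr fun k c s m => forall_congr' fun h => ?_
    rw [hY.conRel_iff hYe h.inter.2.2.1, hY.conRel_iff hYe h.avoid.2.2.1]
  constructor
  · rintro ⟨Y, hY, hYe, hunif⟩
    obtain ⟨y, hy⟩ := hY.1
    obtain ⟨A, hA, hyA, -⟩ := h𝒜.exists_subset_of_mem_open (Set.mem_univ y) isOpen_univ
    obtain ⟨n, hn, rfl⟩ := νA.exists_val_eq hA
    refine ⟨⟨f n, (hY.conRel_iff hYe (hf n hn).1).2 ⟨y, ?_, hy⟩⟩, (hCon hY hYe).1 hunif⟩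
    rwa [(hf n hn).2]
  · rintro ⟨⟨b, -, Y, hY, -, hYe⟩, h⟩
    exact ⟨Y, hY, hYe, (hCon hY hYe).2 h⟩

theorem isPiThreeIn_setOf_isUniformlyWeaklyMicrotransitiveOn [PolishSpace G]
    [ContinuousSMul G X] (h𝒜 : TopologicalSpace.IsTopologicalBasis 𝒜) (hℬ : IsVaughtAlgebra G ℬ)
    (hcomp : IsComputableBasis νN νA νB) :
    IsPiThreeIn (ConRel G νA νB) {e | ∃ Y, IsCanonicalPiece G 𝒜 Y ∧ Codes (G := G) νA e Y ∧
      IsUniformlyWeaklyMicrotransitiveOn G 𝒜 Y} := by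
  obtain ⟨f, hf, hf_val⟩ := hcomp.translation
  -- `(e, v, (b, i), a, a', k, c, s, m)`, in the notation of `IsLocalTest`
  let T := ℕ × ℕ × (ℕ × ℕ) × ℕ × ℕ × ℕ × ℕ × ℕ × ℕ
  have hv : Computable fun q : T => q.2.1 := .comp .fst .snd
  have hbi : Computable fun q : T => q.2.2.1 := .comp .fst <| .comp .snd .snd
  have ha : Computable fun q : T => q.2.2.2 := .comp .snd <| .comp .snd .snd
  have ha' : Computable fun q : T => q.2.2.2.2 := .comp .snd ha
  have hk : Computable fun q : T => q.2.2.2.2.2 := .comp .snd ha'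
  have hc : Computable fun q : T => q.2.2.2.2.2.2 := .comp .snd hk
  have hs : Computable fun q : T => q.2.2.2.2.2.2.2 := .comp .snd hc
  have hCon {n : T → ℕ} (hn : Computable n) :
      ComputablePredIn {relOracle (ConRel G νA νB)} fun q : T => ConRel G νA νB q.1 (n q) :=
    (computablePredIn_relOracle (ConRel G νA νB)).comp (Computable.fst.pair hn)
  have htest := computablePredIn_isLocalTest (O := {relOracle (ConRel G νA νB)}) hcomp hf hv
    (.comp .snd hbi) (.comp .fst ha) (.comp .fst ha') (.comp .fst hk) (.comp .fst hc)
    (.comp .fst hs) (.comp .snd hs)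
  convert isPiThreeIn_setOf ((hCon (.comp .fst hbi)).and
    (htest.imp ((hCon (.comp .fst hk)).and (hCon (.comp .snd hs))).not)) using 1
  ext e
  rw [Set.mem_ofPred_eq,
    exists_codes_and_isUniformlyWeaklyMicrotransitiveOn_iff (νN := νN) h𝒜 hℬ hf_val]
  simp only [Set.mem_ofPred_eq, Prod.forall, Prod.exists, forall_and, forall_const,
    exists_and_left, exists_and_right]

end Complexity

end PolishAction

theorem proposition2p5_general
    (G : Subgroup (Equiv.Perm ℕ)) (hG : IsClosed (G : Set (Equiv.Perm ℕ)))
    {X : Type*} [MetricSpace X] [MulAction G X] [ContinuousSMul G X]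
    (𝒜 : Set (Set X)) (h_open : ∀ A ∈ 𝒜, IsOpen A)
    (h_clopen : TopologicalSpace.IsTopologicalBasis {A ∈ 𝒜 | IsClopen A})
    (ℬ : Set (Set X)) (hℬ : IsVaughtAlgebra G ℬ)
    (νN : FamilyNumbering (basicSets G)) (νA : FamilyNumbering 𝒜) (νB : FamilyNumbering ℬ)
    (hcomp : IsComputableBasis νN νA νB) :
    ∃ 𝒪 : Set ℕ,
      (∀ e ∈ 𝒪, ∃ Y : Set X, IsCanonicalPiece G 𝒜 Y ∧ Codes (G := G) νA e Y ∧
        ∃ x : X, Y = MulAction.orbit G x) ∧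
      (∀ (e : ℕ) (Y : Set X), IsCanonicalPiece G 𝒜 Y → IsCompact Y →
        (∃ x : X, Y = MulAction.orbit G x) → Codes (G := G) νA e Y → e ∈ 𝒪) ∧
      IsPiThreeIn (ConRel G νA νB) 𝒪 := by
  have : PolishSpace G := hG.polishSpace
  have h𝒜 : TopologicalSpace.IsTopologicalBasis 𝒜 :=
    h_clopen.of_isOpen_of_subset h_open (Set.sep_subset ..)
  refine ⟨{e | ∃ Y, IsCanonicalPiece G 𝒜 Y ∧ Codes (G := G) νA e Y ∧
    IsUniformlyWeaklyMicrotransitiveOn G 𝒜 Y}, ?_, ?_,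
    isPiThreeIn_setOf_isUniformlyWeaklyMicrotransitiveOn h𝒜 hℬ hcomp⟩
  · rintro e ⟨Y, hY, hYe, hunif⟩
    have := hY.isMinimal_toSubMulAction h𝒜
    exact ⟨Y, hY, hYe, (exists_eq_orbit_iff_isPretransitive (S := hY.toSubMulAction) hY.1).2
      (hunif.isPretransitive h_clopen)⟩
  · intro e Y hY hY_compact hY_orbit hYe
    have := (exists_eq_orbit_iff_isPretransitive (S := hY.toSubMulAction) hY.1).1 hY_orbit
    exact ⟨Y, hY, hYe, isUniformlyWeaklyMicrotransitiveOn_of_isCompact (S := hY.toSubMulAction)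
      h_open hY_compact⟩

theorem proposition2p5
    (G : Subgroup (Equiv.Perm ℕ)) (hG : IsClosed (G : Set (Equiv.Perm ℕ)))
    {X : Type*} [MetricSpace X] [PolishSpace X] [CompactSpace X]
    [MulAction G X] [ContinuousSMul G X]
    (𝒜 : Set (Set X)) (h𝒜 : IsAdmissibleBasis G 𝒜)
    (ℬ : Set (Set X)) (hℬ : IsNiceBasis G ℬ)
    (νN : FamilyNumbering (basicSets G)) (νA : FamilyNumbering 𝒜) (νB : FamilyNumbering ℬ)
    (hcomp : IsComputableBasis νN νA νB) :
    ∃ 𝒪 : Set ℕ,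
      (∀ e ∈ 𝒪, ∃ Y : Set X, IsCanonicalPiece G 𝒜 Y ∧ Codes (G := G) νA e Y ∧
        ∃ x : X, Y = MulAction.orbit G x) ∧
      (∀ (e : ℕ) (Y : Set X), IsCanonicalPiece G 𝒜 Y → IsClosed Y →
        (∃ x : X, Y = MulAction.orbit G x) → Codes (G := G) νA e Y → e ∈ 𝒪) ∧
      IsPiThreeIn (ConRel G νA νB) 𝒪 := by
  obtain ⟨𝒪, h_orbit, h_mem, h_pi⟩ := proposition2p5_general G hG 𝒜
    (fun _ hA => h𝒜.basis.isOpen hA) h𝒜.isTopologicalBasis_isClopen ℬ hℬ.isVaughtAlgebra νN νA νB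
    hcomp
  exact ⟨𝒪, h_orbit, fun e Y hY hY_closed => h_mem e Y hY hY_closed.isCompact, h_pi⟩
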